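/- For points $x_1,\dots,x_n\in\mathbb R^2$ let $$C(x_1,\dots,x_n)=\min_{F}\Big(|F|+\sum_{i=1}^n\min_{f\in F}\|x_i-f\|\Big),$$ where $F$ ranges over the nonempty finite subsets of $[0,1]^2$ and $\|\cdot\|$ is the Euclidean norm. For $n\ge 1$ let $X_1,\dots,X_n$ be independent and uniformly distributed on $[0,1]^2$, and let $C_n=C(X_1,\dots,X_n)$. (1) There is an absolute constant $K>0$ such that for every $n\ge 1$ the random variable $C_n$ is integrable and, for every real $t\ge 0$, $$\Pr(C_n-\mathbb E C_n\ge t)\le e^{-t^2/(Kn^{1/3})},\qquad \Pr(C_n-\mathbb E C_n\le -t)\le e^{-t^2/(Kn^{1/3})},$$ $$\Pr(|C_n-\mathbb E C_n|\ge t)\le 2\,e^{-t^2/(Kn^{1/3})},$$ and moreover, whenever $t\ge Kn^{1/6}$, $$\Pr(|C_n-\mathbb E C_n|\ge t)\le e^{-t^2/(Kn^{1/3})}.$$ (2) Consequently $C_n$ is concentrated in an interval of length $O(n^{1/6})$: for every $\varepsilon>0$ there is $A>0$ such that $\Pr(|C_n-\mathbb E C_n|\ge A n^{1/6})\le\varepsilon$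 for all $n\ge 1$. -/

import Mathlib

open MeasureTheory ProbabilityTheory

noncomputable section

namespace FacilityLocation

/-- The plane with its Euclidean norm. -/
abbrev Plane : Type := EuclideanSpace ℝ (Fin 2)

/-- The closed unit square `[0,1]²`. -/
def unitSquare : Set Plane := {x | ∀ i, x i ∈ Set.Icc (0 : ℝ) 1}

/-- The admissible facility sets: the nonempty finite subsets of the unit square
(an infinite set of facilities has infinite cost and never matters). -/
def FacilitySet : Type := {F : Finset Plane // F.Nonempty ∧ (F : Set Plane) ⊆ unitSquare}

/-- Cost of the facility set `F` for the points `x₁, …, xₙ`: the number of facilities plus the sum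
of the Euclidean distances of the points to their nearest facility. -/
def cost {n : ℕ} (x : Fin n → Plane) (F : FacilitySet) : ℝ :=
  (F.1.card : ℝ) + ∑ i, Metric.infDist (x i) (F.1 : Set Plane)

/-- The optimal facility location cost of the points `x₁, …, xₙ`. -/
def optCost {n : ℕ} (x : Fin n → Plane) : ℝ := ⨅ F : FacilitySet, cost x F

/-- `X₁, …, Xₙ` are independent and uniformly distributed on the unit square. -/
structure IsUniformSample {Ω : Type*} [MeasurableSpace Ω] (P : Measure Ω) {n : ℕ}
    (X : Fin n → Ω → Plane) : Prop where
  indep : iIndepFun X P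
  uniform : ∀ i, pdf.IsUniform (X i) unitSquare P volume

/-- The random variable `Cₙ`. -/
def randCost {Ω : Type*} {n : ℕ} (X : Fin n → Ω → Plane) (ω : Ω) : ℝ :=
  optCost fun i => X i ω

end FacilityLocation

end

/-!
The tail bounds come from Hoeffding's lemma applied to the martingale that reveals the points one at
a time. The work lies in bounding the influence of one point when `k` points are still to come by
`O((k + 1)^(-1/3))`, which makes the sum of the squared influences `O(n^(1/3))`.

Adding a point `p` to a configuration never lowers the cost, and it raises the cost by at most the
distance `d` from `p` to an optimal facility set. If `N` points of the configuration lie within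
distance `r` of `p`, then a new facility at `p` would save `d - 2 r` for each of them at a price of
`1`, so optimality forces `d ≤ 2 r + 1 / N` (`IsOpeningCost.assignCost_cons_sub_mul_le`). Only the
`k` points that are still random are counted in `N`: a disc of radius `r` has mass at least
`r² / 4`, hence `E[1 / (1 + N)] = O(1 / ((k + 1) r²))` (`integral_inv_one_add_pointCount_le`), and
the choice `r = (k + 1)^(-1/3)` gives the bound on the influence
(`IsOpeningCost.integral_assignCost_cons_mem_Icc`).

The points already revealed are absorbed into the price of a facility set. The induction over the
number of remaining points (`IsOpeningCost.hasSubgaussianMGF_assignCost`) therefore runs over all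
prices for which an additional facility costs at most `1`, and each step is an application of
Fubini's theorem on a product space (`hasSubgaussianMGF_prod`), without conditional expectations.
-/

open MeasureTheory ProbabilityTheory

/-! ### Facility location with general opening costs -/

namespace FacilityLocation

/-- The facility set `F` with one more facility opened at the point `p` of the unit square. -/
noncomputable def FacilitySet.open (F : FacilitySet) (p : Plane) (hp : p ∈ unitSquare) :
    FacilitySet :=
  open scoped Classical in
  ⟨insert p F.1, F.1.insert_nonempty p, by
    rw [Finset.coe_insert]; exact Set.insert_subset hp F.2.2⟩

lemma FacilitySet.coe_open (F : FacilitySet) (p : Plane) (hp : p ∈ unitSquare) :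
    ((F.open p hp).1 : Set Plane) = insert p (F.1 : Set Plane) := by
  classical
  simp [FacilitySet.open]

lemma FacilitySet.coe_nonempty (F : FacilitySet) : (F.1 : Set Plane).Nonempty :=
  Finset.coe_nonempty.2 F.2.1

lemma zero_mem_unitSquare : (0 : Plane) ∈ unitSquare := fun i => by simp

instance : Nonempty FacilitySet := ⟨⟨{0}, by simp, by simpa using zero_mem_unitSquare⟩⟩

lemma infDist_open_le (F : FacilitySet) (p : Plane) (hp : p ∈ unitSquare) (x : Plane) :
    Metric.infDist x ((F.open p hp).1 : Set Plane) ≤ Metric.infDist x (F.1 : Set Plane) := by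
  rw [F.coe_open]
  exact Metric.infDist_le_infDist_of_subset (Set.subset_insert _ _) F.coe_nonempty

lemma infDist_open_le_dist (F : FacilitySet) (p : Plane) (hp : p ∈ unitSquare) (x : Plane) :
    Metric.infDist x ((F.open p hp).1 : Set Plane) ≤ dist x p :=
  Metric.infDist_le_dist_of_mem (by rw [F.coe_open]; exact Set.mem_insert _ _)

/-- A nonnegative price for facility sets such that one more facility costs at most `1`. The number
of facilities is such a price, and it remains one when the assignment costs of some fixed points
are added to it; this is how points that have already been revealed are recorded. -/
structure IsOpeningCost (φ : FacilitySet → ℝ) : Prop where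
  nonneg : ∀ F, 0 ≤ φ F
  open_le : ∀ F p hp, φ (F.open p hp) ≤ φ F + 1

lemma isOpeningCost_card : IsOpeningCost fun F => (F.1.card : ℝ) where
  nonneg F := Nat.cast_nonneg _
  open_le F p hp := by
    classical
    have h : (F.open p hp).1.card ≤ F.1.card + 1 := by
      simpa [FacilitySet.open] using Finset.card_insert_le p F.1
    exact_mod_cast h

lemma IsOpeningCost.add_infDist {φ : FacilitySet → ℝ} (hφ : IsOpeningCost φ) (p : Plane) :
    IsOpeningCost fun F => φ F + Metric.infDist p (F.1 : Set Plane) where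
  nonneg F := add_nonneg (hφ.nonneg F) Metric.infDist_nonneg
  open_le F q hq := by linarith [hφ.open_le F q hq, infDist_open_le F q hq p]

/-- The optimal facility location cost of the points `x₁, …, xₖ` when the facility set `F` costs
`φ F`; for `φ F = |F|` it is `optCost` by definition. -/
noncomputable def assignCost (φ : FacilitySet → ℝ) {k : ℕ} (x : Fin k → Plane) : ℝ :=
  ⨅ F : FacilitySet, (φ F + ∑ i, Metric.infDist (x i) (F.1 : Set Plane))

/-- The number of the points `x₁, …, xₖ` in the set `s`, as a real number. -/
noncomputable def pointCount {α : Type*} (s : Set α) {k : ℕ} (x : Fin k → α) : ℝ :=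
  ∑ i, s.indicator 1 (x i)

lemma pointCount_nonneg {α : Type*} (s : Set α) {k : ℕ} (x : Fin k → α) : 0 ≤ pointCount s x :=
  Finset.sum_nonneg fun _ _ => Set.indicator_nonneg (fun _ _ => zero_le_one) _

namespace IsOpeningCost

variable {φ : FacilitySet → ℝ} {k : ℕ}

lemma assignCost_le (hφ : IsOpeningCost φ) (x : Fin k → Plane) (F : FacilitySet) :
    assignCost φ x ≤ φ F + ∑ i, Metric.infDist (x i) (F.1 : Set Plane) := by
  refine ciInf_le ⟨0, ?_⟩ F
  rintro _ ⟨G, rfl⟩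
  exact add_nonneg (hφ.nonneg G) (Finset.sum_nonneg fun i _ => Metric.infDist_nonneg)

lemma assignCost_nonneg (hφ : IsOpeningCost φ) (x : Fin k → Plane) : 0 ≤ assignCost φ x :=
  Real.iInf_nonneg fun G =>
    add_nonneg (hφ.nonneg G) (Finset.sum_nonneg fun _ _ => Metric.infDist_nonneg)

lemma continuous_assignCost (hφ : IsOpeningCost φ) :
    Continuous (assignCost φ : (Fin k → Plane) → ℝ) := by
  refine (LipschitzWith.of_le_add_mul (k : NNReal) fun x y => ?_).continuous
  rw [← sub_le_iff_le_add]
  refine le_ciInf fun F => ?_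
  rw [sub_le_iff_le_add]
  have h : ∑ i, Metric.infDist (x i) (F.1 : Set Plane) ≤
      ∑ i, Metric.infDist (y i) (F.1 : Set Plane) + k * dist x y := by
    calc ∑ i, Metric.infDist (x i) (F.1 : Set Plane)
        ≤ ∑ i, (Metric.infDist (y i) (F.1 : Set Plane) + dist x y) :=
          Finset.sum_le_sum fun i _ => Metric.infDist_le_infDist_add_dist.trans
            (by gcongr; exact dist_le_pi_dist x y i)
      _ = _ := by simp [Finset.sum_add_distrib]
  have := hφ.assignCost_le x F
  push_cast
  linarith

lemma assignCost_cons (φ : FacilitySet → ℝ) (p : Plane) (x : Fin k → Plane) :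
    assignCost φ (Fin.cons p x : Fin (k + 1) → Plane) =
      assignCost (fun F => φ F + Metric.infDist p (F.1 : Set Plane)) x := by
  simp [assignCost, Fin.sum_univ_succ, add_assoc]

/-- Opening a facility at every point bounds the optimal cost. -/
lemma assignCost_le_add_card (hφ : IsOpeningCost φ) (F : FacilitySet) (x : Fin k → Plane)
    (hx : ∀ i, x i ∈ unitSquare) : assignCost φ x ≤ φ F + k := by
  induction k generalizing φ F with
  | zero => simpa using hφ.assignCost_le x F
  | succ k ih =>
    rw [← Fin.cons_self_tail x, assignCost_cons]
    have h := ih (hφ.add_infDist (x 0)) (F.open (x 0) (hx 0)) (Fin.tail x) fun i => hx _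
    have h1 := hφ.open_le F (x 0) (hx 0)
    have h2 := infDist_open_le_dist F (x 0) (hx 0) (x 0)
    rw [dist_self] at h2
    push_cast
    linarith

lemma assignCost_le_cons (hφ : IsOpeningCost φ) (p : Plane) (x : Fin k → Plane) :
    assignCost φ x ≤ assignCost φ (Fin.cons p x : Fin (k + 1) → Plane) := by
  rw [assignCost_cons]
  refine le_ciInf fun F => (hφ.assignCost_le x F).trans ?_
  have : 0 ≤ Metric.infDist p (F.1 : Set Plane) := Metric.infDist_nonneg
  linarith

/-- A further point can be served by a new facility of its own. -/
lemma assignCost_cons_le_add_one (hφ : IsOpeningCost φ) {p : Plane} (hp : p ∈ unitSquare)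
    (x : Fin k → Plane) :
    assignCost φ (Fin.cons p x : Fin (k + 1) → Plane) ≤ assignCost φ x + 1 := by
  rw [assignCost_cons, ← sub_le_iff_le_add]
  refine le_ciInf fun F => ?_
  rw [sub_le_iff_le_add]
  refine ((hφ.add_infDist p).assignCost_le x (F.open p hp)).trans ?_
  have h1 := hφ.open_le F p hp
  have h2 := infDist_open_le_dist F p hp p
  rw [dist_self] at h2
  have h3 : ∑ i, Metric.infDist (x i) ((F.open p hp).1 : Set Plane) ≤
      ∑ i, Metric.infDist (x i) (F.1 : Set Plane) :=
    Finset.sum_le_sum fun i _ => infDist_open_le F p hp _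
  linarith

/-- In a nearly optimal facility set `F`, the distance `d` from `p` to `F` cannot be large when many
points lie near `p`: a new facility at `p` would save `d - 2 r` for each of the `N` points within
distance `r` of `p`, so `N * (d - 2 * r)` is at most about `1`, the price of the new facility. -/
lemma assignCost_cons_sub_mul_le (hφ : IsOpeningCost φ) {p : Plane} (hp : p ∈ unitSquare)
    (x : Fin k → Plane) (r : ℝ) :
    pointCount (Metric.closedBall p r) x *
      (assignCost φ (Fin.cons p x : Fin (k + 1) → Plane) - assignCost φ x - 2 * r) ≤ 1 := by
  set N := pointCount (Metric.closedBall p r) x with hN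
  have hN0 : 0 ≤ N := pointCount_nonneg _ _
  refine le_of_forall_pos_le_add fun δ hδ => ?_
  obtain ⟨ε, hε, hεδ⟩ : ∃ ε : ℝ, 0 < ε ∧ (N + 1) * ε ≤ δ :=
    ⟨δ / (N + 1), by positivity, by field_simp; exact le_refl _⟩
  obtain ⟨F, hF⟩ := exists_lt_of_ciInf_lt
    (show assignCost φ x < assignCost φ x + ε by linarith)
  set d := Metric.infDist p (F.1 : Set Plane) with hd
  have h1 : assignCost φ (Fin.cons p x : Fin (k + 1) → Plane) ≤ assignCost φ x + ε + d := by
    rw [assignCost_cons]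
    have := (hφ.add_infDist p).assignCost_le x F
    linarith
  have h2 : ∑ i, Metric.infDist (x i) ((F.open p hp).1 : Set Plane) ≤
      ∑ i, Metric.infDist (x i) (F.1 : Set Plane) - N * (d - 2 * r) := by
    rw [hN, pointCount, Finset.sum_mul, ← Finset.sum_sub_distrib]
    refine Finset.sum_le_sum fun i _ => ?_
    by_cases hi : x i ∈ Metric.closedBall p r
    · have h3 := infDist_open_le_dist F p hp (x i)
      have h4 : d ≤ Metric.infDist (x i) (F.1 : Set Plane) + dist p (x i) :=
        Metric.infDist_le_infDist_add_dist
      rw [dist_comm] at h4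
      have h5 := Metric.mem_closedBall.1 hi
      rw [Set.indicator_of_mem hi, Pi.one_apply]
      linarith
    · rw [Set.indicator_of_notMem hi]
      simpa using infDist_open_le F p hp (x i)
  have h3 := hφ.assignCost_le x (F.open p hp)
  have h4 := hφ.open_le F p hp
  have h5 : N * (assignCost φ (Fin.cons p x : Fin (k + 1) → Plane) - assignCost φ x - 2 * r) ≤
      N * (d - 2 * r + ε) := by gcongr; linarith
  linarith

lemma assignCost_cons_le (hφ : IsOpeningCost φ) {p : Plane} (hp : p ∈ unitSquare)
    (x : Fin k → Plane) {r : ℝ} (hr : 0 ≤ r) :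
    assignCost φ (Fin.cons p x : Fin (k + 1) → Plane) ≤
      assignCost φ x + (2 * r + 2 * (1 + pointCount (Metric.closedBall p r) x)⁻¹) := by
  have h1 := hφ.assignCost_cons_sub_mul_le hp x r
  have h2 := hφ.assignCost_cons_le_add_one hp x
  have hN := pointCount_nonneg (Metric.closedBall p r) x
  set N := pointCount (Metric.closedBall p r) x
  set D := assignCost φ (Fin.cons p x : Fin (k + 1) → Plane) - assignCost φ x with hD
  -- adding the two bounds gives `(1 + N) * (D - 2 * r) ≤ 2`
  have h3 : D - 2 * r ≤ 2 * (1 + N)⁻¹ := by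
    rw [← div_eq_mul_inv, le_div_iff₀ (by positivity)]
    linarith
  linarith

end IsOpeningCost

/-! ### The uniform distribution on the unit square -/

lemma volume_box (a b : Fin 2 → ℝ) :
    volume {x : Plane | ∀ i, x i ∈ Set.Icc (a i) (b i)} = ∏ i, ENNReal.ofReal (b i - a i) := by
  have h := (PiLp.volume_preserving_ofLp (Fin 2)).measure_preimage
    (measurableSet_Icc (a := a) (b := b)).nullMeasurableSet
  rw [Real.volume_Icc_pi] at h
  rw [← h]
  congr 1
  ext x
  simp [Pi.le_def, forall_and, -Fin.forall_fin_two]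

lemma volume_unitSquare : volume unitSquare = 1 := by
  have := volume_box 0 1
  simpa [unitSquare] using this

lemma measurableSet_unitSquare : MeasurableSet unitSquare := by
  refine MeasurableSet.congr (s := ⋂ i, {x : Plane | x i ∈ Set.Icc (0 : ℝ) 1})
    (MeasurableSet.iInter fun i => ?_) (by ext x; simp [unitSquare])
  exact measurableSet_Icc.preimage (by fun_prop)

/-- The uniform distribution on the unit square. -/
noncomputable def uniformSquare : Measure Plane := ProbabilityTheory.cond volume unitSquare

instance : IsProbabilityMeasure uniformSquare :=
  cond_isProbabilityMeasure_of_finite (by simp [volume_unitSquare]) (by simp [volume_unitSquare])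

lemma ae_mem_unitSquare : ∀ᵐ x ∂uniformSquare, x ∈ unitSquare :=
  ae_cond_mem measurableSet_unitSquare

/-- A disc of radius `r ≤ 1` about a point of the unit square has at least `r² / 4` of the mass:
it contains a square of side `r / 2` that has a corner at its centre and lies in the unit square. -/
lemma uniformSquare_closedBall_ge {p : Plane} (hp : p ∈ unitSquare) {r : ℝ} (hr : 0 ≤ r)
    (hr1 : r ≤ 1) : r ^ 2 / 4 ≤ uniformSquare.real (Metric.closedBall p r) := by
  let a : Fin 2 → ℝ := fun i => if p i ≤ 1 / 2 then p i else p i - r / 2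
  have key : {x : Plane | ∀ i, x i ∈ Set.Icc (a i) (a i + r / 2)} ⊆
      unitSquare ∩ Metric.closedBall p r := by
    intro x hx
    have hx' : ∀ i, (0 ≤ x i ∧ x i ≤ 1) ∧ |x i - p i| ≤ r / 2 := by
      intro i
      have h1 := hx i
      have h2 := hp i
      simp only [a, Set.mem_Icc] at h1 h2
      rw [abs_le]
      split_ifs at h1 <;> refine ⟨⟨?_, ?_⟩, ?_, ?_⟩ <;> linarith
    refine ⟨fun i => (hx' i).1, ?_⟩
    rw [Metric.mem_closedBall, ← sq_le_sq₀ dist_nonneg hr, EuclideanSpace.dist_sq_eq,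
      Fin.sum_univ_two, Real.dist_eq, Real.dist_eq]
    have h0 := pow_le_pow_left₀ (abs_nonneg _) (hx' 0).2 2
    have h1 := pow_le_pow_left₀ (abs_nonneg _) (hx' 1).2 2
    nlinarith
  have hvol : volume {x : Plane | ∀ i, x i ∈ Set.Icc (a i) (a i + r / 2)} =
      ENNReal.ofReal (r ^ 2 / 4) := by
    rw [volume_box a fun i => a i + r / 2]
    simp only [add_sub_cancel_left, Fin.prod_univ_two]
    rw [← ENNReal.ofReal_mul (by positivity)]
    congr 1
    ring
  have hle : ENNReal.ofReal (r ^ 2 / 4) ≤ uniformSquare (Metric.closedBall p r) := by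
    rw [uniformSquare, ProbabilityTheory.cond_apply measurableSet_unitSquare, volume_unitSquare,
      inv_one, one_mul, ← hvol]
    exact measure_mono key
  exact (ENNReal.ofReal_le_iff_le_toReal (measure_ne_top _ _)).1 hle

/-! ### The number of sample points in a set -/

lemma measurable_pointCount {α : Type*} [MeasurableSpace α] {s : Set α} (hs : MeasurableSet s)
    (k : ℕ) : Measurable fun x : Fin k → α => pointCount s x :=
  Finset.measurable_sum _ fun i _ => (measurable_one.indicator hs).comp (measurable_pi_apply i)

/-- If `N` counts which of `k` independent points of law `μ` lie in `s`, then
`E[1 / (1 + N)] ≤ 1 / ((k + 1) μ(s))`. Among `k + 1` independent points, the expectation of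
`1{yⱼ ∈ s} / #{i | yᵢ ∈ s}` is `μ(s) E[1 / (1 + N)]` for each `j`, and the sum over `j` of these
variables is at most `1`. -/
lemma integral_inv_one_add_pointCount_le {α : Type*} [MeasurableSpace α] (μ : Measure α)
    [IsProbabilityMeasure μ] {s : Set α} (hs : MeasurableSet s) (k : ℕ) :
    ((k : ℝ) + 1) * (μ.real s *
      ∫ x, (1 + pointCount s x)⁻¹ ∂(Measure.pi fun _ : Fin k => μ)) ≤ 1 := by
  let G : Fin (k + 1) → (Fin (k + 1) → α) → ℝ := fun j y =>
    s.indicator 1 (y j) * (1 + pointCount s fun i => y (j.succAbove i))⁻¹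
  have hGm : ∀ j, Measurable (G j) := fun j =>
    ((measurable_one.indicator hs).comp (measurable_pi_apply j)).mul
      (((measurable_pointCount hs k).comp
        (measurable_pi_lambda _ fun i => measurable_pi_apply _)).const_add 1).inv
  have hG0 : ∀ j y, 0 ≤ G j y := fun j y =>
    mul_nonneg (Set.indicator_nonneg (fun _ _ => zero_le_one) _)
      (inv_nonneg.2 (add_nonneg zero_le_one (pointCount_nonneg _ _)))
  have hGeq : ∀ j y, G j y = s.indicator 1 (y j) * (pointCount s y)⁻¹ := by
    intro j y
    by_cases hj : y j ∈ s
    · simp [G, pointCount, Fin.sum_univ_succAbove _ j, hj]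
    · simp [G, hj]
  have hsum : ∀ y, ∑ j, G j y ≤ 1 := by
    intro y
    simp_rw [hGeq]
    rw [← Finset.sum_mul]
    exact mul_inv_le_one
  have hint : ∀ j, Integrable (G j) (Measure.pi fun _ => μ) := by
    intro j
    refine Integrable.of_bound (hGm j).aestronglyMeasurable 1
      (Filter.Eventually.of_forall fun y => ?_)
    rw [Real.norm_of_nonneg (hG0 j y)]
    exact (Finset.single_le_sum (fun i _ => hG0 i y) (Finset.mem_univ j)).trans (hsum y)
  have hGint : ∀ j, ∫ y, G j y ∂(Measure.pi fun _ => μ) =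
      μ.real s * ∫ x, (1 + pointCount s x)⁻¹ ∂(Measure.pi fun _ : Fin k => μ) := by
    intro j
    have h := (measurePreserving_piFinSuccAbove (fun _ : Fin (k + 1) => μ) j).integral_comp'
      (fun z : α × (Fin k → α) => s.indicator (1 : α → ℝ) z.1 * (1 + pointCount s z.2)⁻¹)
    exact h.trans ((integral_prod_mul (s.indicator (1 : α → ℝ))
      fun x : Fin k → α => (1 + pointCount s x)⁻¹).trans (by rw [integral_indicator_one hs]))
  calc ((k : ℝ) + 1) * (μ.real s *
      ∫ x, (1 + pointCount s x)⁻¹ ∂(Measure.pi fun _ : Fin k => μ))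
      = ∑ j, ∫ y, G j y ∂(Measure.pi fun _ => μ) := by simp [hGint]
    _ = ∫ y, ∑ j, G j y ∂(Measure.pi fun _ => μ) := (integral_finsetSum _ fun j _ => hint j).symm
    _ ≤ ∫ _, 1 ∂(Measure.pi fun _ : Fin (k + 1) => μ) :=
        integral_mono (integrable_finsetSum _ fun j _ => hint j) (integrable_const _) hsum
    _ = 1 := by simp

/-! ### Sub-Gaussian fluctuations on product spaces -/

/-- One step of the martingale method: on a product space, the fluctuation of `f` splits into that
of its partial integral and that of its sections, and the variance parameters add up. -/
lemma hasSubgaussianMGF_prod {α β : Type*} [MeasurableSpace α] [MeasurableSpace β]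
    {μ : Measure α} {ν : Measure β} [IsProbabilityMeasure μ] [IsProbabilityMeasure ν]
    {f : α × β → ℝ} (hf : Measurable f) {a b : ℝ} (hfb : ∀ᵐ z ∂μ.prod ν, f z ∈ Set.Icc a b)
    {c₁ c₂ : NNReal}
    (h₁ : HasSubgaussianMGF (fun x => ∫ y, f (x, y) ∂ν - ∫ z, f z ∂μ.prod ν) c₁ μ)
    (h₂ : ∀ᵐ x ∂μ, HasSubgaussianMGF (fun y => f (x, y) - ∫ y', f (x, y') ∂ν) c₂ ν) :
    HasSubgaussianMGF (fun z => f z - ∫ z', f z' ∂μ.prod ν) (c₁ + c₂) (μ.prod ν) := by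
  set m := ∫ z, f z ∂μ.prod ν with hm
  have hint : ∀ t, Integrable (fun z => Real.exp (t * (f z - m))) (μ.prod ν) := fun t =>
    integrable_exp_mul_of_mem_Icc (a := a - m) (b := b - m) (hf.sub_const m).aemeasurable
      (by filter_upwards [hfb] with z hz using ⟨by linarith [hz.1], by linarith [hz.2]⟩)
  refine ⟨hint, fun t => ?_⟩
  have hsec : ∀ᵐ x ∂μ, ∫ y, Real.exp (t * (f (x, y) - m)) ∂ν ≤
      Real.exp (t * (∫ y, f (x, y) ∂ν - m)) * Real.exp (c₂ * t ^ 2 / 2) := by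
    filter_upwards [h₂] with x hx
    have h := hx.mgf_le t
    rw [mgf] at h
    calc ∫ y, Real.exp (t * (f (x, y) - m)) ∂ν
        = ∫ y, Real.exp (t * (∫ y, f (x, y) ∂ν - m)) *
            Real.exp (t * (f (x, y) - ∫ y', f (x, y') ∂ν)) ∂ν := by
          congr 1
          ext y
          rw [← Real.exp_add]
          ring_nf
      _ = Real.exp (t * (∫ y, f (x, y) ∂ν - m)) *
            ∫ y, Real.exp (t * (f (x, y) - ∫ y', f (x, y') ∂ν)) ∂ν := integral_const_mul _ _
      _ ≤ _ := by gcongr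
  calc mgf (fun z => f z - m) (μ.prod ν) t
      = ∫ x, ∫ y, Real.exp (t * (f (x, y) - m)) ∂ν ∂μ := integral_prod _ (hint t)
    _ ≤ ∫ x, Real.exp (t * (∫ y, f (x, y) ∂ν - m)) * Real.exp (c₂ * t ^ 2 / 2) ∂μ :=
        integral_mono_ae (hint t).integral_prod_left
          ((h₁.integrable_exp_mul t).mul_const _) hsec
    _ = mgf (fun x => ∫ y, f (x, y) ∂ν - m) μ t * Real.exp (c₂ * t ^ 2 / 2) :=
        integral_mul_const _ _
    _ ≤ Real.exp (c₁ * t ^ 2 / 2) * Real.exp (c₂ * t ^ 2 / 2) := by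
        gcongr
        exact h₁.mgf_le t
    _ = Real.exp ((c₁ + c₂ : NNReal) * t ^ 2 / 2) := by
        rw [← Real.exp_add]
        push_cast
        ring_nf

/-! ### Concentration of the assignment cost -/

namespace IsOpeningCost

variable {φ : FacilitySet → ℝ} {k : ℕ}

lemma exists_assignCost_mem_Icc (hφ : IsOpeningCost φ) (k : ℕ) :
    ∃ b, ∀ᵐ x ∂(Measure.pi fun _ : Fin k => uniformSquare), assignCost φ x ∈ Set.Icc 0 b := by
  let F := Classical.arbitrary FacilitySet
  refine ⟨φ F + k, ?_⟩
  have h : ∀ᵐ x ∂(Measure.pi fun _ : Fin k => uniformSquare), ∀ i, x i ∈ unitSquare :=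
    ae_all_iff.2 fun i => (measurePreserving_eval (fun _ : Fin k => uniformSquare)
      i).quasiMeasurePreserving.ae ae_mem_unitSquare
  filter_upwards [h] with x hx
  exact ⟨hφ.assignCost_nonneg x, hφ.assignCost_le_add_card F x hx⟩

lemma integrable_assignCost (hφ : IsOpeningCost φ) (k : ℕ) :
    Integrable (assignCost φ) (Measure.pi fun _ : Fin k => uniformSquare) := by
  obtain ⟨b, hb⟩ := hφ.exists_assignCost_mem_Icc k
  exact Integrable.of_mem_Icc 0 b hφ.continuous_assignCost.measurable.aemeasurable hb

lemma integrable_assignCost_cons (hφ : IsOpeningCost φ) (k : ℕ) (p : Plane) :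
    Integrable (fun x => assignCost φ (Fin.cons p x : Fin (k + 1) → Plane))
      (Measure.pi fun _ : Fin k => uniformSquare) := by
  simp_rw [assignCost_cons]
  exact (hφ.add_infDist p).integrable_assignCost k

/-- A point `p` added to `k` random points raises the expected cost by `O((k + 1)^(-1/3))`. The
radius `r = (k + 1)^(-1/3)` balances `r` against the reciprocal `1 / ((k + 1) r²)` of the number of
points expected within distance `r` of `p`. -/
lemma integral_assignCost_cons_mem_Icc (hφ : IsOpeningCost φ) (k : ℕ) {p : Plane}
    (hp : p ∈ unitSquare) :
    ∫ x, assignCost φ (Fin.cons p x : Fin (k + 1) → Plane)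
        ∂(Measure.pi fun _ : Fin k => uniformSquare) ∈
      Set.Icc (∫ x, assignCost φ x ∂(Measure.pi fun _ : Fin k => uniformSquare))
        (∫ x, assignCost φ x ∂(Measure.pi fun _ : Fin k => uniformSquare) +
          10 * ((k : ℝ) + 1) ^ (-(1 / 3) : ℝ)) := by
  have hk : (0 : ℝ) < k + 1 := by positivity
  refine ⟨integral_mono (hφ.integrable_assignCost k) (hφ.integrable_assignCost_cons k p)
    fun x => hφ.assignCost_le_cons p x, ?_⟩
  set r : ℝ := ((k : ℝ) + 1) ^ (-(1 / 3) : ℝ) with hr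
  have hr0 : 0 < r := Real.rpow_pos_of_pos hk _
  have hr1 : r ≤ 1 := Real.rpow_le_one_of_one_le_of_nonpos (by simp) (by norm_num)
  have hr3 : ((k : ℝ) + 1) * r ^ 3 = 1 := by
    rw [hr, ← Real.rpow_natCast, ← Real.rpow_mul hk.le]
    norm_num
    rw [Real.rpow_neg_one, mul_inv_cancel₀ hk.ne']
  set B := Metric.closedBall p r
  set ν := Measure.pi fun _ : Fin k => uniformSquare
  have hB : MeasurableSet B := Metric.isClosed_closedBall.measurableSet
  have hint : Integrable (fun x => (1 + pointCount B x)⁻¹) ν := by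
    refine Integrable.of_bound
      ((measurable_pointCount hB k).const_add 1).inv.aestronglyMeasurable 1
      (Filter.Eventually.of_forall fun x => ?_)
    have := pointCount_nonneg B x
    rw [Real.norm_of_nonneg (by positivity)]
    exact inv_le_one_of_one_le₀ (by linarith)
  have hI : ∫ x, (1 + pointCount B x)⁻¹ ∂ν ≤ 4 * r := by
    have h1 := integral_inv_one_add_pointCount_le uniformSquare hB k
    have h2 := uniformSquare_closedBall_ge hp hr0.le hr1
    have h0 : 0 ≤ ∫ x, (1 + pointCount B x)⁻¹ ∂ν := integral_nonneg fun x =>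
      inv_nonneg.2 (add_nonneg zero_le_one (pointCount_nonneg _ _))
    set I := ∫ x, (1 + pointCount B x)⁻¹ ∂ν
    have h3 : ((k : ℝ) + 1) * (r ^ 2 / 4 * I) ≤ 1 := by
      refine le_trans ?_ h1
      gcongr
    calc I = ((k : ℝ) + 1) * r ^ 3 * I := by rw [hr3, one_mul]
      _ = 4 * r * (((k : ℝ) + 1) * (r ^ 2 / 4 * I)) := by ring
      _ ≤ 4 * r * 1 := by gcongr
      _ = 4 * r := mul_one _
  have hint' : Integrable (fun x => 2 * r + 2 * (1 + pointCount B x)⁻¹) ν :=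
    (integrable_const _).add (hint.const_mul 2)
  calc ∫ x, assignCost φ (Fin.cons p x : Fin (k + 1) → Plane) ∂ν
      ≤ ∫ x, (assignCost φ x + (2 * r + 2 * (1 + pointCount B x)⁻¹)) ∂ν :=
        integral_mono (hφ.integrable_assignCost_cons k p)
          ((hφ.integrable_assignCost k).add hint')
          fun x => hφ.assignCost_cons_le hp x hr0.le
    _ = ∫ x, assignCost φ x ∂ν + (2 * r + 2 * ∫ x, (1 + pointCount B x)⁻¹ ∂ν) := by
        rw [integral_add (hφ.integrable_assignCost k) hint',
          integral_add (integrable_const _) (hint.const_mul 2)]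
        simp [integral_const_mul, ν]
    _ ≤ _ := by linarith

end IsOpeningCost

/-- The variance parameter for `k` random points: the sum of the Hoeffding parameters `(a / 2)²` of
the martingale differences, whose ranges have lengths `a = 10 (j + 1)^(-1/3)` for `j < k`. -/
noncomputable def varianceParam (k : ℕ) : NNReal :=
  ∑ j ∈ Finset.range k, (‖10 * ((j : ℝ) + 1) ^ (-(1 / 3) : ℝ)‖₊ / 2) ^ 2

lemma IsOpeningCost.hasSubgaussianMGF_assignCost {φ : FacilitySet → ℝ} (hφ : IsOpeningCost φ)
    (k : ℕ) :
    HasSubgaussianMGF (fun x => assignCost φ x -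
        ∫ y, assignCost φ y ∂(Measure.pi fun _ : Fin k => uniformSquare)) (varianceParam k)
      (Measure.pi fun _ : Fin k => uniformSquare) := by
  induction k generalizing φ with
  | zero =>
    have h : ∀ x : Fin 0 → Plane, assignCost φ x = assignCost φ ![] := fun x => by
      rw [Subsingleton.elim x ![]]
    simp [varianceParam, h]
  | succ k ih =>
    set ν := Measure.pi fun _ : Fin k => uniformSquare with hν
    let f : Plane × (Fin k → Plane) → ℝ := fun z => assignCost φ (Fin.cons z.1 z.2)
    have hf : Measurable f :=
      (hφ.continuous_assignCost.comp (Continuous.finCons (A := fun _ => Plane) continuous_fst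
        continuous_snd)).measurable
    have hmp := measurePreserving_piFinSuccAbove (fun _ : Fin (k + 1) => uniformSquare) 0
    set e := MeasurableEquiv.piFinSuccAbove (fun _ : Fin (k + 1) => Plane) 0
    have hfe : ∀ x, f (e x) = assignCost φ x := fun x =>
      congrArg (assignCost φ) (Fin.cons_self_tail x)
    obtain ⟨b, hb⟩ := hφ.exists_assignCost_mem_Icc (k + 1)
    have hfb : ∀ᵐ z ∂uniformSquare.prod ν, f z ∈ Set.Icc 0 b := by
      rw [← hmp.map_eq, ae_map_iff hmp.measurable.aemeasurable (hf measurableSet_Icc)]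
      simpa only [hfe] using hb
    have hfint : Integrable f (uniformSquare.prod ν) :=
      Integrable.of_mem_Icc 0 b hf.aemeasurable hfb
    have h₁ : HasSubgaussianMGF (fun p => ∫ x, f (p, x) ∂ν - ∫ z, f z ∂uniformSquare.prod ν)
        ((‖10 * ((k : ℝ) + 1) ^ (-(1 / 3) : ℝ)‖₊ / 2) ^ 2) uniformSquare := by
      have := hasSubgaussianMGF_of_mem_Icc (μ := uniformSquare) (X := fun p => ∫ x, f (p, x) ∂ν)
        (a := ∫ x, assignCost φ x ∂ν)
        (b := ∫ x, assignCost φ x ∂ν + 10 * ((k : ℝ) + 1) ^ (-(1 / 3) : ℝ))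
        hfint.integral_prod_left.aemeasurable
        (by filter_upwards [ae_mem_unitSquare] with p hp
              using hφ.integral_assignCost_cons_mem_Icc k hp)
      rwa [add_sub_cancel_left, ← integral_prod f hfint] at this
    have h₂ : ∀ p, HasSubgaussianMGF (fun x => f (p, x) - ∫ x', f (p, x') ∂ν)
        (varianceParam k) ν := fun p => by
      simpa only [f, IsOpeningCost.assignCost_cons] using ih (hφ.add_infDist p)
    have h := hasSubgaussianMGF_prod hf hfb h₁ (Filter.Eventually.of_forall h₂)
    rw [← hmp.map_eq] at h
    have h' := h.of_map hmp.measurable.aemeasurable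
    rw [hmp.map_eq, ← hmp.integral_comp'] at h'
    rw [varianceParam, Finset.sum_range_succ, ← varianceParam, add_comm (varianceParam k)]
    simpa only [Function.comp_def, hfe] using h'

lemma varianceParam_le (k : ℕ) : (varianceParam k : ℝ) ≤ 75 * (k : ℝ) ^ (1 / 3 : ℝ) := by
  induction k with
  | zero => simp [varianceParam]
  | succ k ih =>
    rw [varianceParam, Finset.sum_range_succ, ← varianceParam]
    have hk : (0 : ℝ) < k + 1 := by positivity
    set u : ℝ := ((k : ℝ) + 1) ^ (1 / 3 : ℝ) with hu
    set v : ℝ := (k : ℝ) ^ (1 / 3 : ℝ) with hv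
    have hu0 : 0 < u := Real.rpow_pos_of_pos hk _
    have hv0 : 0 ≤ v := Real.rpow_nonneg (Nat.cast_nonneg _) _
    have hvu : v ≤ u := Real.rpow_le_rpow (Nat.cast_nonneg _) (by linarith) (by norm_num)
    have hu3 : u ^ 3 = k + 1 := by
      rw [hu, ← Real.rpow_natCast, ← Real.rpow_mul hk.le]
      norm_num
    have hv3 : v ^ 3 = k := by
      rw [hv, ← Real.rpow_natCast, ← Real.rpow_mul (Nat.cast_nonneg _)]
      norm_num
    have hinv : ((k : ℝ) + 1) ^ (-(1 / 3) : ℝ) = u⁻¹ := Real.rpow_neg hk.le _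
    -- `1 = u³ - v³ = (u - v) (u² + u v + v²) ≤ 3 u² (u - v)`
    have hstep : u⁻¹ ^ 2 ≤ 3 * (u - v) := by
      rw [inv_pow, inv_le_iff_one_le_mul₀ (by positivity)]
      nlinarith [mul_nonneg (mul_nonneg hu0.le (sub_nonneg.2 hvu)) (sub_nonneg.2 hvu),
        mul_nonneg (mul_nonneg hv0 (sub_nonneg.2 hvu)) (sub_nonneg.2 hvu)]
    push_cast
    rw [hinv, ← hu, Real.norm_of_nonneg (by positivity)]
    nlinarith

/-! ### Concentration of the cost of a uniform sample -/

lemma IsUniformSample.map_eq {Ω : Type*} [MeasurableSpace Ω] {P : Measure Ω} {n : ℕ}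
    {X : Fin n → Ω → Plane} (hX : IsUniformSample P X) :
    AEMeasurable (fun ω i => X i ω) P ∧
      P.map (fun ω i => X i ω) = Measure.pi fun _ => uniformSquare := by
  have hm : ∀ i, AEMeasurable (X i) P := fun i =>
    (hX.uniform i).aemeasurable (by simp [volume_unitSquare]) (by simp [volume_unitSquare])
  refine ⟨aemeasurable_pi_lambda _ hm, ?_⟩
  rw [hX.indep.map_fun_eq_pi_map hm]
  congr 1
  ext1 i
  exact hX.uniform i

lemma IsUniformSample.hasSubgaussianMGF {Ω : Type*} [MeasurableSpace Ω] {P : Measure Ω} {n : ℕ}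
    {X : Fin n → Ω → Plane} (hX : IsUniformSample P X) :
    HasSubgaussianMGF (fun ω => randCost X ω - ∫ ω', randCost X ω' ∂P) (varianceParam n) P := by
  obtain ⟨hm, hmap⟩ := hX.map_eq
  have h := isOpeningCost_card.hasSubgaussianMGF_assignCost n
  rw [← hmap, integral_map hm
    isOpeningCost_card.continuous_assignCost.measurable.aestronglyMeasurable] at h
  exact h.of_map hm

lemma IsUniformSample.integrable_randCost {Ω : Type*} [MeasurableSpace Ω] {P : Measure Ω} {n : ℕ}
    {X : Fin n → Ω → Plane} (hX : IsUniformSample P X) : Integrable (randCost X) P := by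
  obtain ⟨hm, hmap⟩ := hX.map_eq
  have h := isOpeningCost_card.integrable_assignCost n
  rw [← hmap] at h
  exact h.comp_aemeasurable hm

lemma measureReal_ge_le_of_varianceParam {Ω : Type*} [MeasurableSpace Ω] {P : Measure Ω}
    {Y : Ω → ℝ} {n : ℕ} (hn : 1 ≤ n) (hY : HasSubgaussianMGF Y (varianceParam n) P) {t : ℝ}
    (ht : 0 ≤ t) :
    P.real {ω | t ≤ Y ω} ≤ Real.exp (-t ^ 2 / (150 * (n : ℝ) ^ (1 / 3 : ℝ))) := by
  refine (hY.measure_ge_le ht).trans (Real.exp_le_exp.2 ?_)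
  have h0 : 0 < varianceParam n :=
    Finset.sum_pos (fun j _ => by
      have : 10 * ((j : ℝ) + 1) ^ (-(1 / 3) : ℝ) ≠ 0 := by positivity
      have := nnnorm_pos.2 this
      positivity) (Finset.nonempty_range_iff.2 (by omega))
  have h0' : (0 : ℝ) < varianceParam n := h0
  rw [neg_div, neg_div, neg_le_neg_iff]
  exact div_le_div_of_nonneg_left (sq_nonneg t) (by positivity) (by linarith [varianceParam_le n])

lemma IsUniformSample.tail_le {Ω : Type*} [MeasurableSpace Ω] {P : Measure Ω}
    [IsProbabilityMeasure P] {n : ℕ} (hn : 1 ≤ n)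
    {X : Fin n → Ω → Plane} (hX : IsUniformSample P X) {t : ℝ} (ht : 0 ≤ t) :
    P.real {ω | t ≤ randCost X ω - ∫ ω', randCost X ω' ∂P}
        ≤ Real.exp (-t ^ 2 / (150 * (n : ℝ) ^ (1 / 3 : ℝ))) ∧
      P.real {ω | randCost X ω - ∫ ω', randCost X ω' ∂P ≤ -t}
        ≤ Real.exp (-t ^ 2 / (150 * (n : ℝ) ^ (1 / 3 : ℝ))) ∧
      P.real {ω | t ≤ |randCost X ω - ∫ ω', randCost X ω' ∂P|}
        ≤ 2 * Real.exp (-t ^ 2 / (150 * (n : ℝ) ^ (1 / 3 : ℝ))) := by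
  have h1 := measureReal_ge_le_of_varianceParam hn hX.hasSubgaussianMGF ht
  have h2 := measureReal_ge_le_of_varianceParam hn hX.hasSubgaussianMGF.neg ht
  simp only [Pi.neg_apply, le_neg (a := t)] at h2
  refine ⟨h1, h2, ?_⟩
  have h3 : {ω | t ≤ |randCost X ω - ∫ ω', randCost X ω' ∂P|} =
      {ω | t ≤ randCost X ω - ∫ ω', randCost X ω' ∂P} ∪
        {ω | randCost X ω - ∫ ω', randCost X ω' ∂P ≤ -t} := by
    ext ω
    exact (le_abs' (b := randCost X ω - ∫ ω', randCost X ω' ∂P)).trans or_comm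
  rw [h3]
  linarith [measureReal_union_le (μ := P) {ω | t ≤ randCost X ω - ∫ ω', randCost X ω' ∂P}
    {ω | randCost X ω - ∫ ω', randCost X ω' ∂P ≤ -t}]

/-- Above the scale `√(2 c)`, halving the rate of a Gaussian bound absorbs a prefactor `2`. -/
lemma two_mul_exp_neg_sq_div_le {c t : ℝ} (hc : 0 < c) (h : 2 * c ≤ t ^ 2) :
    2 * Real.exp (-t ^ 2 / c) ≤ Real.exp (-t ^ 2 / (2 * c)) := by
  have h1 : -t ^ 2 / c = -t ^ 2 / (2 * c) + -t ^ 2 / (2 * c) := by field_simp; ring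
  have h2 : 2 * Real.exp (-t ^ 2 / (2 * c)) ≤ 1 := by
    calc 2 * Real.exp (-t ^ 2 / (2 * c)) ≤ 2 * Real.exp (-1) := by
          gcongr
          rw [div_le_iff₀ (by positivity)]
          linarith
      _ ≤ 1 := by
          have := Real.exp_neg_one_lt_half
          linarith
  rw [h1, Real.exp_add, ← mul_assoc]
  exact mul_le_of_le_one_left (Real.exp_pos _).le h2

lemma sq_rpow_one_sixth (n : ℕ) : ((n : ℝ) ^ (1 / 6 : ℝ)) ^ 2 = (n : ℝ) ^ (1 / 3 : ℝ) := by
  rw [← Real.rpow_natCast, ← Real.rpow_mul (Nat.cast_nonneg n)]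
  norm_num

end FacilityLocation

theorem theorem3p3 :
    (∃ K : ℝ, 0 < K ∧
      ∀ (n : ℕ), 1 ≤ n →
      ∀ (Ω : Type*) [MeasurableSpace Ω] (P : Measure Ω) [IsProbabilityMeasure P]
        (X : Fin n → Ω → FacilityLocation.Plane), FacilityLocation.IsUniformSample P X →
        Integrable (FacilityLocation.randCost X) P ∧
        ∀ t : ℝ, 0 ≤ t →
          -- each one-sided tail, for all `t ≥ 0`
          P.real {ω | t ≤ FacilityLocation.randCost X ω - ∫ ω', FacilityLocation.randCost X ω' ∂P}
              ≤ Real.exp (-t ^ 2 / (K * (n : ℝ) ^ (1 / 3 : ℝ))) ∧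
          P.real {ω | FacilityLocation.randCost X ω - ∫ ω', FacilityLocation.randCost X ω' ∂P ≤ -t}
              ≤ Real.exp (-t ^ 2 / (K * (n : ℝ) ^ (1 / 3 : ℝ))) ∧
          -- both tails together, for all `t ≥ 0`
          P.real {ω | t ≤ |FacilityLocation.randCost X ω
                - ∫ ω', FacilityLocation.randCost X ω' ∂P|}
              ≤ 2 * Real.exp (-t ^ 2 / (K * (n : ℝ) ^ (1 / 3 : ℝ))) ∧
          -- both tails together with prefactor one, above the scale `n ^ (1/6)`
          (K * (n : ℝ) ^ (1 / 6 : ℝ) ≤ t →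
            P.real {ω | t ≤ |FacilityLocation.randCost X ω
                - ∫ ω', FacilityLocation.randCost X ω' ∂P|}
              ≤ Real.exp (-t ^ 2 / (K * (n : ℝ) ^ (1 / 3 : ℝ))))) ∧
    -- concentration in an interval of length `O(n ^ (1/6))`
    (∀ ε : ℝ, 0 < ε → ∃ A : ℝ, 0 < A ∧
      ∀ (n : ℕ), 1 ≤ n →
      ∀ (Ω : Type*) [MeasurableSpace Ω] (P : Measure Ω) [IsProbabilityMeasure P]
        (X : Fin n → Ω → FacilityLocation.Plane), FacilityLocation.IsUniformSample P X →
        P.real {ω | A * (n : ℝ) ^ (1 / 6 : ℝ) ≤ |FacilityLocation.randCost X ω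
            - ∫ ω', FacilityLocation.randCost X ω' ∂P|} ≤ ε) := by
  refine ⟨⟨300, by norm_num, fun n hn Ω _ P _ X hX => ⟨hX.integrable_randCost, fun t ht => ?_⟩⟩,
    fun ε hε => ?_⟩
  · have hn0 : (0 : ℝ) < n := by exact_mod_cast hn
    have hc : 0 < (n : ℝ) ^ (1 / 3 : ℝ) := Real.rpow_pos_of_pos hn0 _
    obtain ⟨h1, h2, h3⟩ := hX.tail_le hn ht
    have hmono : Real.exp (-t ^ 2 / (150 * (n : ℝ) ^ (1 / 3 : ℝ))) ≤
        Real.exp (-t ^ 2 / (300 * (n : ℝ) ^ (1 / 3 : ℝ))) := by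
      rw [Real.exp_le_exp, neg_div, neg_div, neg_le_neg_iff]
      gcongr
      norm_num
    refine ⟨h1.trans hmono, h2.trans hmono, h3.trans (by gcongr), fun hlarge => ?_⟩
    refine h3.trans ?_
    have hsq : (300 * (n : ℝ) ^ (1 / 6 : ℝ)) ^ 2 ≤ t ^ 2 := by gcongr
    rw [mul_pow, FacilityLocation.sq_rpow_one_sixth] at hsq
    have := FacilityLocation.two_mul_exp_neg_sq_div_le
      (c := 150 * (n : ℝ) ^ (1 / 3 : ℝ)) (t := t) (by positivity) (by linarith)
    rwa [← mul_assoc, show (2 : ℝ) * 150 = 300 by norm_num] at this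
  · -- `A` is chosen with `2 * exp (-A² / 150) ≤ ε`, using `exp (-s) ≤ 1 / s`
    refine ⟨√(300 / ε), by positivity, fun n hn Ω _ P _ X hX => ?_⟩
    have hn0 : (0 : ℝ) < n := by exact_mod_cast hn
    have hc : 0 < (n : ℝ) ^ (1 / 3 : ℝ) := Real.rpow_pos_of_pos hn0 _
    refine (hX.tail_le hn (t := √(300 / ε) * (n : ℝ) ^ (1 / 6 : ℝ)) (by positivity)).2.2.trans ?_
    rw [mul_pow, FacilityLocation.sq_rpow_one_sixth, Real.sq_sqrt (by positivity)]
    have h1 : -(300 / ε * (n : ℝ) ^ (1 / 3 : ℝ)) / (150 * (n : ℝ) ^ (1 / 3 : ℝ)) = -(2 / ε) := by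
      field_simp
      norm_num
    have h2 : 2 / ε ≤ Real.exp (2 / ε) := by linarith [Real.add_one_le_exp (2 / ε)]
    rw [h1, Real.exp_neg]
    calc 2 * (Real.exp (2 / ε))⁻¹ ≤ 2 * (2 / ε)⁻¹ := by gcongr
      _ = ε := by field_simp
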